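/- For every $c>0$ there is a constant $c_0>0$, depending only on $c$, with the following property. Let $x:M^3\to\mathbb{R}^4$ be a smooth immersion of a smooth $3$-manifold, let $M$ carry the metric induced by $x$, let $\nabla$ be its Levi-Civita connection, and let $\eta$ be a smooth unit normal field along $x$. Let $A$ be the shape operator, $\langle A(X),Y\rangle=\langle B(X,Y),\eta\rangle$ with $B$ the second fundamental form of $x$, let $\lambda_1,\lambda_2,\lambda_3$ be its eigenvalues, and put $H=\lambda_1+\lambda_2+\lambda_3$, $R=\lambda_1\lambda_2+\lambda_1\lambda_3+\lambda_2\lambda_3$ and $K=\lambda_1\lambda_2\lambda_3$. If $R=0$ and $\frac{-K}{H^3}\ge c$ everywhere on $M$ (so in particular $H\neq 0$ everywhere), then at every point of $M$ $$|\nabla A|^2-|\nabla H|^2\ \ge\ \frac{2}{1+2c_0^2}\,|\nabla H|^2,$$ where $\nabla H$ is the gradient of $H$, and $|\nabla A|$ is the norm of the tensor $\nabla A(X,Y,Z)=\langle\nabla_Z(A(X))-A(\nabla_ZX),Y\rangle$. -/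

import Mathlib

open scoped Manifold ContDiff Matrix

universe u

noncomputable section

namespace Hypersurface

/-- The coordinate space `ℝ³` in which the charts of a `3`-manifold take their values. -/
abbrev E3 : Type := EuclideanSpace ℝ (Fin 3)

/-- The ambient Euclidean space `ℝ⁴`. -/
abbrev E4 : Type := EuclideanSpace ℝ (Fin 4)

section Local

/-- The partial derivative `∂ᵢ f`. -/
def pd {F : Type*} [NormedAddCommGroup F] [NormedSpace ℝ F] (i : Fin 3) (f : E3 → F) (u : E3) : F :=
  fderiv ℝ f u (EuclideanSpace.single i 1)

/-- The induced metric `gᵢⱼ = ⟨∂ᵢX, ∂ⱼX⟩` of a local parametrization `X`. -/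
def metric (X : E3 → E4) (u : E3) : Matrix (Fin 3) (Fin 3) ℝ :=
  Matrix.of fun i j => inner ℝ (pd i X u) (pd j X u)

/-- The coefficients `⟨B(∂ᵢ, ∂ⱼ), N⟩ = ⟨∂ᵢ∂ⱼX, N⟩` of the second fundamental form with respect to
the unit normal `N`. -/
def secondForm (X N : E3 → E4) (u : E3) : Matrix (Fin 3) (Fin 3) ℝ :=
  Matrix.of fun i j => inner ℝ (pd i (pd j X) u) (N u)

/-- The matrix of the shape operator `A` in the coordinate frame: `A ∂ᵢ = ∑ₘ Aₘᵢ ∂ₘ`, that is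
`⟨A ∂ᵢ, ∂ⱼ⟩ = ⟨B(∂ᵢ, ∂ⱼ), N⟩`. -/
def shape (X N : E3 → E4) (u : E3) : Matrix (Fin 3) (Fin 3) ℝ :=
  (metric X u)⁻¹ * secondForm X N u

/-- The Christoffel symbol `Γᵐᵢⱼ` of the Levi-Civita connection of the induced metric:
`∇_{∂ᵢ} ∂ⱼ = ∑ₘ Γᵐᵢⱼ ∂ₘ`. -/
def christoffel (X : E3 → E4) (m i j : Fin 3) (u : E3) : ℝ :=
  (1 / 2) * ∑ l, (metric X u)⁻¹ m l *
    (pd i (fun v => metric X v j l) u + pd j (fun v => metric X v i l) u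
      - pd l (fun v => metric X v i j) u)

/-- The components of the Levi-Civita derivative `∇_{∂ₖ} Y` of the vector field `∑ₘ Yₘ ∂ₘ`. -/
def covDeriv (X : E3 → E4) (k : Fin 3) (Y : E3 → Fin 3 → ℝ) (u : E3) : Fin 3 → ℝ :=
  fun m => pd k (fun v => Y v m) u + ∑ l, christoffel X m k l u * Y u l

/-- The components of the coordinate vector field `∂ᵢ`. -/
def coordField (i : Fin 3) : E3 → Fin 3 → ℝ :=
  fun _ => Pi.single i 1

/-- `∇A(∂ᵢ, ∂ⱼ, ∂ₖ) = ⟨∇_{∂ₖ}(A ∂ᵢ) - A(∇_{∂ₖ} ∂ᵢ), ∂ⱼ⟩`. -/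
def nablaShape (X N : E3 → E4) (i j k : Fin 3) (u : E3) : ℝ :=
  (covDeriv X k (fun v => shape X N v *ᵥ coordField i v) u
      - shape X N u *ᵥ covDeriv X k (coordField i) u)
    ⬝ᵥ (metric X u *ᵥ coordField j u)

end Local

section Global

variable {M : Type u} [TopologicalSpace M] [ChartedSpace E3 M]

/-- The expression of `f` in the preferred chart at `p`. -/
def inChart {F : Type*} (f : M → F) (p : M) : E3 → F :=
  fun u => f ((extChartAt (𝓡 3) p).symm u)

/-- The coordinates of `p` in the preferred chart at `p`. -/
def coord (p : M) : E3 :=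
  extChartAt (𝓡 3) p p

/-- `x : M³ → ℝ⁴` is a smooth immersion and `η` is a smooth unit normal field along it. The metric
of `M` is the one induced by `x`. -/
structure IsImmersedHypersurface (x η : M → E4) : Prop where
  contMDiff_immersion : ContMDiff (𝓡 3) (𝓡 4) ∞ x
  injective_mfderiv : ∀ p, Function.Injective (mfderiv (𝓡 3) (𝓡 4) x p)
  contMDiff_normal : ContMDiff (𝓡 3) (𝓡 4) ∞ η
  norm_normal : ∀ p, ‖η p‖ = 1
  inner_normal : ∀ (p : M) (v : TangentSpace (𝓡 3) p),
    inner ℝ (η p) (mfderiv (𝓡 3) (𝓡 4) x p v) = 0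

/-- The metric at `p` in the preferred chart at `p`. -/
def metricAt (x : M → E4) (p : M) : Matrix (Fin 3) (Fin 3) ℝ :=
  metric (inChart x p) (coord p)

/-- The matrix of the shape operator at `p` in the preferred chart at `p`. -/
def shapeAt (x η : M → E4) (p : M) : Matrix (Fin 3) (Fin 3) ℝ :=
  shape (inChart x p) (inChart η p) (coord p)

/-- The non-normalized mean curvature `H = λ₁ + λ₂ + λ₃`, the trace of the shape operator. -/
def meanCurvature (x η : M → E4) (p : M) : ℝ :=
  (shapeAt x η p).trace

/-- The scalar curvature `R = λ₁λ₂ + λ₁λ₃ + λ₂λ₃`, the sum of the principal `2 × 2` minors of the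
shape operator. -/
def scalarCurvature (x η : M → E4) (p : M) : ℝ :=
  let S := shapeAt x η p
  (S 0 0 * S 1 1 - S 0 1 * S 1 0) + (S 0 0 * S 2 2 - S 0 2 * S 2 0)
    + (S 1 1 * S 2 2 - S 1 2 * S 2 1)

/-- The Gauss-Kronecker curvature `K = λ₁λ₂λ₃`, the determinant of the shape operator. -/
def gaussKronecker (x η : M → E4) (p : M) : ℝ :=
  (shapeAt x η p).det

/-- `|∇f|² = ∑ gⁱʲ ∂ᵢf ∂ⱼf`, the squared norm of the gradient of `f : M → ℝ` in the metric induced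
by `x`. -/
def normSqGrad (x : M → E4) (f : M → ℝ) (p : M) : ℝ :=
  ∑ i, ∑ j, (metricAt x p)⁻¹ i j * pd i (inChart f p) (coord p) * pd j (inChart f p) (coord p)

/-- `|∇A|²`, the squared norm of the tensor `∇A` in the metric induced by `x`: the full contraction
`∑ gⁱᵃ gʲᵇ gᵏᶜ ∇A(∂ᵢ, ∂ⱼ, ∂ₖ) ∇A(∂ₐ, ∂_b, ∂_c)`. -/
def normSqNablaShape (x η : M → E4) (p : M) : ℝ :=
  ∑ i, ∑ j, ∑ k, ∑ a, ∑ b, ∑ c,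
    (metricAt x p)⁻¹ i a * (metricAt x p)⁻¹ j b * (metricAt x p)⁻¹ k c
      * nablaShape (inChart x p) (inChart η p) i j k (coord p)
      * nablaShape (inChart x p) (inChart η p) a b c (coord p)

end Global

end Hypersurface

end

/-! At a point, choose an orthonormal principal frame. By the Codazzi equations in flat ℝ⁴, T = ∇A
is totally symmetric. Since R = 0 says H² = |A|², differentiating gives H ∂ₖH = ∑ᵢ λᵢ Tᵢᵢₖ, that is
∑ᵢ (1 - λᵢ/H) Tᵢᵢₖ = 0 for each k. The numbers xᵢ = λᵢ/H have sum 1 and sum of squares 1, and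
satisfy xᵢ²(1 - xᵢ) = -K/H³ ≥ c, so the weights 1 - xᵢ lie in [c, 2].

For fixed k, total symmetry makes each Tᵢᵢₖ with i ≠ k occur three times in |T|². It remains to
bound (a + b + d)² by a² + 3b² + 3d² - (a + b + d)² on the plane cut out by the weighted relation:
this is `kato_quadratic`. Summing over k and dropping T₀₁₂ gives |∇H|² ≤ 2(1 + 2/c)² (|∇A|² -
|∇H|²).

Around this core, `kato_arbitrary_frame` passes from coordinate frames to principal frames, and
`nablaShape_eq_symmetric` supplies Codazzi. Finally, `exists_shapeAt_eq` reconciles the different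
charts in which H is evaluated at neighbouring points. -/

noncomputable section

namespace Hypersurface

/-! ### Pointwise linear algebra: the Kato-type inequality for symmetric trilinear forms. -/

section Algebra

/-- A real symmetric matrix is diagonalized by an orthogonal matrix. -/
theorem exists_orthogonal_diagonal {A : Matrix (Fin 3) (Fin 3) ℝ} (hA : A.IsHermitian) :
    ∃ (U : Matrix (Fin 3) (Fin 3) ℝ) (d : Fin 3 → ℝ), Uᵀ * U = 1 ∧ Uᵀ * A * U = .diagonal d := by
  have hU : star (hA.eigenvectorUnitary : Matrix (Fin 3) (Fin 3) ℝ) * hA.eigenvectorUnitary = 1 :=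
    Unitary.coe_star_mul_self _
  refine ⟨hA.eigenvectorUnitary, hA.eigenvalues, ?_, ?_⟩
  · simpa [Matrix.star_eq_conjTranspose, Matrix.conjTranspose_eq_transpose_of_trivial] using hU
  · have h := hA.spectral_theorem
    rw [Unitary.conjStarAlgAut_apply] at h
    have hs : (hA.eigenvectorUnitary : Matrix (Fin 3) (Fin 3) ℝ)ᵀ
        = star (hA.eigenvectorUnitary : Matrix (Fin 3) (Fin 3) ℝ) := by
      simp [Matrix.star_eq_conjTranspose, Matrix.conjTranspose_eq_transpose_of_trivial]
    rw [hs]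
    set V : Matrix (Fin 3) (Fin 3) ℝ := hA.eigenvectorUnitary.1
    set D : Matrix (Fin 3) (Fin 3) ℝ := .diagonal hA.eigenvalues
    have h' : A = V * D * star V := h
    calc star V * A * V = star V * (V * D * star V) * V := by rw [← h']
      _ = (star V * V) * D * (star V * V) := by simp only [Matrix.mul_assoc]
      _ = D := by rw [hU]; simp

/-- A positive definite and a symmetric form are simultaneously diagonalizable. -/
theorem exists_simultaneous_diagonal {G h : Matrix (Fin 3) (Fin 3) ℝ} (hG : G.PosDef)
    (hh : h.IsHermitian) :
    ∃ (P : Matrix (Fin 3) (Fin 3) ℝ) (d : Fin 3 → ℝ),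
      G⁻¹ = P * Pᵀ ∧ Pᵀ * h * P = .diagonal d := by
  obtain ⟨U, m, hU, hUG⟩ := exists_orthogonal_diagonal hG.1
  have hU' : U * Uᵀ = 1 := mul_eq_one_comm.mp hU
  have hm : ∀ i, 0 < m i := by
    have h1 : (Uᵀ * G * U).PosDef := by
      have := hG.conjTranspose_mul_mul_same (B := U)
        (Matrix.mulVec_injective_of_isUnit (IsUnit.of_mul_eq_one Uᵀ hU'))
      rwa [Matrix.conjTranspose_eq_transpose_of_trivial] at this
    rw [hUG] at h1
    exact Matrix.posDef_diagonal_iff.mp h1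
  -- With E = m^(-1/2), the columns of `U * E` are `G`-orthonormal. A further orthogonal `V` keeps
  -- them so while diagonalizing `h`.
  set E : Matrix (Fin 3) (Fin 3) ℝ := .diagonal fun i => (√(m i))⁻¹ with hE
  have hEt : Eᵀ = E := Matrix.diagonal_transpose _
  have hEE : .diagonal m * (E * E) = 1 := by
    rw [hE, Matrix.diagonal_mul_diagonal, Matrix.diagonal_mul_diagonal, ← Matrix.diagonal_one]
    congr 1
    funext i
    have h1 := Real.mul_self_sqrt (hm i).le
    have h2 : √(m i) ≠ 0 := (Real.sqrt_pos.mpr (hm i)).ne'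
    field_simp
    rw [sq, h1]
  have hGU : G = U * .diagonal m * Uᵀ := by
    rw [← hUG]
    calc G = (U * Uᵀ) * G * (U * Uᵀ) := by rw [hU']; simp
      _ = _ := by simp only [Matrix.mul_assoc]
  have hsymm : ((U * E)ᵀ * h * (U * E)).IsHermitian := by
    have := Matrix.isHermitian_conjTranspose_mul_mul (U * E) hh
    rwa [Matrix.conjTranspose_eq_transpose_of_trivial] at this
  obtain ⟨V, d, hV, hd⟩ := exists_orthogonal_diagonal hsymm
  have hV' : V * Vᵀ = 1 := mul_eq_one_comm.mp hV
  refine ⟨U * E * V, d, ?_, ?_⟩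
  · refine Matrix.inv_eq_right_inv ?_
    calc G * (U * E * V * (U * E * V)ᵀ)
        = U * .diagonal m * Uᵀ * (U * E * (V * Vᵀ) * (E * Uᵀ)) := by
          rw [← hGU]; simp only [Matrix.transpose_mul, hEt, Matrix.mul_assoc]
      _ = U * .diagonal m * (Uᵀ * U) * (E * E) * Uᵀ := by
          rw [hV']; simp only [Matrix.mul_assoc, Matrix.mul_one]
      _ = 1 := by
          rw [hU, Matrix.mul_one, Matrix.mul_assoc U, hEE, Matrix.mul_one, hU']
  · rw [← hd]
    simp only [Matrix.transpose_mul, Matrix.mul_assoc]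

/-- Eliminating a through the linear relation leaves a quadratic form in b, d that dominates b² +
d², while a + b + d is linear in b, d with coefficients bounded in terms of c. -/
theorem kato_quadratic {c p q r a b d : ℝ} (hc : 0 < c) (hp : c ≤ p) (hq : c ≤ q) (hr : c ≤ r)
    (h1 : p + q + r = 2) (h2 : p ^ 2 + q ^ 2 + r ^ 2 = 2) (h : p * a + q * b + r * d = 0) :
    (a + b + d) ^ 2 ≤ 2 * (1 + 2 / c) ^ 2 * (a ^ 2 + 3 * b ^ 2 + 3 * d ^ 2 - (a + b + d) ^ 2) := by
  have hp0 : 0 < p := hc.trans_le hp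
  have key : ∀ s, c ≤ s → s ≤ 2 → 0 ≤ s / p ∧ (1 - s / p) ^ 2 ≤ (1 + 2 / c) ^ 2 := by
    intro s hs hs2
    have h0 : 0 ≤ s / p := by have := hc.le.trans hs; positivity
    have h3 : s / p ≤ 2 / c := div_le_div₀ (by norm_num) hs2 hc hp
    exact ⟨h0, sq_le_sq' (by linarith) (by linarith)⟩
  obtain ⟨hα, hα'⟩ := key q hq (by linarith)
  obtain ⟨hβ, hβ'⟩ := key r hr (by linarith)
  -- The two normalizations force (q + r - p)² = 4(1 - p)² = 4qr; this is what makes the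
  -- discriminant below cancel.
  have hcirc : (q / p + r / p - 1) ^ 2 = 4 * (q / p) * (r / p) := by
    field_simp
    nlinarith
  have ha : a = -(q / p * b + r / p * d) := by
    field_simp
    linarith
  generalize q / p = α at *
  generalize r / p = β at *
  have hQ : b ^ 2 + d ^ 2 ≤ a ^ 2 + 3 * b ^ 2 + 3 * d ^ 2 - (a + b + d) ^ 2 := by
    have hpos : 0 < 1 + 2 * α := by linarith
    have : 0 ≤ (1 + 2 * α) * (a ^ 2 + 3 * b ^ 2 + 3 * d ^ 2 - (a + b + d) ^ 2 - (b ^ 2 + d ^ 2)) := by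
      -- Completing the square in b; by `hcirc` the last bracket vanishes and the remaining
      -- coefficient of d² is positive.
      have e : (1 + 2 * α) * (a ^ 2 + 3 * b ^ 2 + 3 * d ^ 2 - (a + b + d) ^ 2 - (b ^ 2 + d ^ 2))
          = ((1 + 2 * α) * b + (α + β - 1) * d) ^ 2 + (1 + 2 * α + 2 * β) * d ^ 2
            + (4 * α * β - (α + β - 1) ^ 2) * d ^ 2 := by rw [ha]; ring
      rw [e, hcirc]
      have : 0 ≤ 1 + 2 * α + 2 * β := by linarith
      nlinarith [sq_nonneg ((1 + 2 * α) * b + (α + β - 1) * d), mul_nonneg this (sq_nonneg d)]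
    nlinarith [nonneg_of_mul_nonneg_right this hpos]
  -- Cauchy–Schwarz for a + b + d = (1 - α) b + (1 - β) d.
  have hS : (a + b + d) ^ 2 ≤ ((1 - α) ^ 2 + (1 - β) ^ 2) * (b ^ 2 + d ^ 2) := by
    rw [ha]
    nlinarith [sq_nonneg ((1 - α) * d - (1 - β) * b)]
  calc (a + b + d) ^ 2 ≤ ((1 - α) ^ 2 + (1 - β) ^ 2) * (b ^ 2 + d ^ 2) := hS
    _ ≤ (2 * (1 + 2 / c) ^ 2) * (b ^ 2 + d ^ 2) := by gcongr; linarith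
    _ ≤ _ := by gcongr

/-- The refined Kato inequality in an orthonormal frame of principal directions. -/
theorem kato_principal_frame {c : ℝ} (hc : 0 < c) (l : Fin 3 → ℝ) (T : Fin 3 → Fin 3 → Fin 3 → ℝ)
    (hT : ∀ i j k, T i j k = T j i k) (hT' : ∀ i j k, T i j k = T i k j)
    (hR : l 0 * l 1 + l 0 * l 2 + l 1 * l 2 = 0)
    (hK : c ≤ -(l 0 * l 1 * l 2) / (l 0 + l 1 + l 2) ^ 3)
    (hdR : ∀ k, (l 0 + l 1 + l 2) * (T 0 0 k + T 1 1 k + T 2 2 k)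
      = l 0 * T 0 0 k + l 1 * T 1 1 k + l 2 * T 2 2 k) :
    ∑ k, (∑ i, T i i k) ^ 2
      ≤ 2 * (1 + 2 / c) ^ 2 * (∑ i, ∑ j, ∑ k, T i j k ^ 2 - ∑ k, (∑ i, T i i k) ^ 2) := by
  have hH : l 0 + l 1 + l 2 ≠ 0 := by
    intro h0
    -- Division by zero has value 0, so H = 0 would give c ≤ 0.
    rw [h0] at hK
    norm_num at hK
    linarith
  set H := l 0 + l 1 + l 2 with hHdef
  obtain ⟨x, hx⟩ : ∃ x, l 0 = H * x := ⟨l 0 / H, by field_simp⟩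
  obtain ⟨y, hy⟩ : ∃ x, l 1 = H * x := ⟨l 1 / H, by field_simp⟩
  obtain ⟨z, hz⟩ : ∃ x, l 2 = H * x := ⟨l 2 / H, by field_simp⟩
  rw [hx, hy, hz] at hR hK
  simp only [hx, hy, hz] at hdR
  have hsum : x + y + z = 1 := mul_left_cancel₀ hH (by rw [mul_add, mul_add, ← hx, ← hy, ← hz]; simp [hHdef])
  have hR' : x * y + x * z + y * z = 0 := by
    have : H ^ 2 * (x * y + x * z + y * z) = 0 := by linarith
    simpa [hH] using this
  have hK' : c ≤ -(x * y * z) := by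
    convert hK using 1
    field_simp
  have hd : ∀ k, (1 - x) * T 0 0 k + (1 - y) * T 1 1 k + (1 - z) * T 2 2 k = 0 := fun k =>
    mul_left_cancel₀ hH (by linarith [hdR k])
  have hsq : x ^ 2 + y ^ 2 + z ^ 2 = 1 := by nlinarith
  -- Used with s = 1 - t for t = x, y, z: t² ≤ 1 and t² s = -xyz ≥ c > 0 force s ≥ c.
  have hw : ∀ t s, t ^ 2 ≤ 1 → t ^ 2 * s = -(x * y * z) → c ≤ s := by
    intro t s ht hs
    have : 0 < s := by
      by_contra hneg
      nlinarith [mul_nonneg (sq_nonneg t) (sub_nonneg.mpr (not_lt.mp hneg)), sq_nonneg t]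
    nlinarith
  have hwx : c ≤ 1 - x := hw x _ (by nlinarith [sq_nonneg y, sq_nonneg z]) (by
    linear_combination (-x ^ 2) * hsum + x * hR')
  have hwy : c ≤ 1 - y := hw y _ (by nlinarith [sq_nonneg x, sq_nonneg z]) (by
    linear_combination (-y ^ 2) * hsum + y * hR')
  have hwz : c ≤ 1 - z := hw z _ (by nlinarith [sq_nonneg x, sq_nonneg y]) (by
    linear_combination (-z ^ 2) * hsum + z * hR')
  -- The distinguished variable a is Tₖₖₖ, the only diagonal entry counted once rather than three
  -- times.
  have k0 := kato_quadratic hc hwx hwy hwz (by linarith) (by linarith) (hd 0)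
  have k1 := kato_quadratic hc hwy hwx hwz (by linarith) (by linarith)
    (a := T 1 1 1) (b := T 0 0 1) (d := T 2 2 1) (by linarith [hd 1])
  have k2 := kato_quadratic hc hwz hwx hwy (by linarith) (by linarith)
    (a := T 2 2 2) (b := T 0 0 2) (d := T 1 1 2) (by linarith [hd 2])
  have hexp : ∑ i, ∑ j, ∑ k, T i j k ^ 2
      = (T 0 0 0 ^ 2 + 3 * T 1 1 0 ^ 2 + 3 * T 2 2 0 ^ 2)
        + (T 1 1 1 ^ 2 + 3 * T 0 0 1 ^ 2 + 3 * T 2 2 1 ^ 2)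
        + (T 2 2 2 ^ 2 + 3 * T 0 0 2 ^ 2 + 3 * T 1 1 2 ^ 2) + 6 * T 0 1 2 ^ 2 := by
    simp only [Fin.sum_univ_three]
    rw [hT' 0 1 0, hT' 0 2 0, hT 1 0 0, hT' 0 1 0, hT 1 0 1, hT' 0 1 1, hT 1 0 2, hT' 1 2 0,
      hT 1 0 2, hT' 1 2 1, hT 2 0 0, hT' 0 2 0, hT 2 0 1, hT' 0 2 1, hT 2 0 2, hT' 0 2 2,
      hT 2 1 0, hT' 1 2 0, hT 1 0 2, hT 2 1 1, hT' 1 2 1, hT 2 1 2, hT' 1 2 2,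
      show T 0 1 1 = T 1 1 0 by rw [hT, hT'], show T 0 2 2 = T 2 2 0 by rw [hT, hT'],
      show T 1 2 2 = T 2 2 1 by rw [hT, hT']]
    ring
  rw [hexp]
  simp only [Fin.sum_univ_three]
  have hpos : 0 ≤ 2 * (1 + 2 / c) ^ 2 * (6 * T 0 1 2 ^ 2) := by positivity
  rw [show T 1 1 1 + T 0 0 1 + T 2 2 1 = T 0 0 1 + T 1 1 1 + T 2 2 1 by ring] at k1
  rw [show T 2 2 2 + T 0 0 2 + T 1 1 2 = T 0 0 2 + T 1 1 2 + T 2 2 2 by ring] at k2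
  linarith

/-- The components of a trilinear form in the frame given by the columns of `P`. -/
def changeFrame (P : Matrix (Fin 3) (Fin 3) ℝ) (T : Fin 3 → Fin 3 → Fin 3 → ℝ) (i j k : Fin 3) : ℝ :=
  ∑ a, ∑ b, ∑ c, P a i * P b j * P c k * T a b c

theorem sum_mul_transpose_eq_sum_sq {ι : Type*} [Fintype ι] (Q : Matrix ι ι ℝ) (f : ι → ℝ) :
    ∑ x, ∑ y, (Q * Qᵀ) x y * (f x * f y) = ∑ s, (∑ x, Q x s * f x) ^ 2 := by
  simp only [Matrix.mul_apply, Matrix.transpose_apply, sq, Finset.sum_mul_sum]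
  rw [Finset.sum_comm (s := Finset.univ (α := ι)) (t := Finset.univ)
    (f := fun s x => ∑ y, Q x s * f x * (Q y s * f y))]
  refine Finset.sum_congr rfl fun x _ => ?_
  rw [Finset.sum_comm]
  refine Finset.sum_congr rfl fun y _ => ?_
  rw [Finset.sum_mul]
  exact Finset.sum_congr rfl fun s _ => by ring

/-- The weight is the Gram matrix of P ⊗ P ⊗ P, so the rank-one identity applies over triples of
indices. With P Pᵀ = G⁻¹ this computes |∇A|² in the orthonormal frame. -/
theorem sum_contract_eq_sum_sq (P : Matrix (Fin 3) (Fin 3) ℝ) (T : Fin 3 → Fin 3 → Fin 3 → ℝ) :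
    ∑ i, ∑ j, ∑ k, ∑ a, ∑ b, ∑ c,
      (P * Pᵀ) i a * (P * Pᵀ) j b * (P * Pᵀ) k c * T i j k * T a b c
      = ∑ i, ∑ j, ∑ k, changeFrame P T i j k ^ 2 := by
  have h := sum_mul_transpose_eq_sum_sq
    (Matrix.of fun x s : Fin 3 × Fin 3 × Fin 3 => P x.1 s.1 * P x.2.1 s.2.1 * P x.2.2 s.2.2)
    (fun x => T x.1 x.2.1 x.2.2)
  simp only [Fintype.sum_prod_type, Matrix.of_apply] at h
  unfold changeFrame
  rw [← h]
  refine Finset.sum_congr rfl fun i _ => Finset.sum_congr rfl fun j _ =>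
    Finset.sum_congr rfl fun k _ => Finset.sum_congr rfl fun a _ =>
    Finset.sum_congr rfl fun b _ => Finset.sum_congr rfl fun c _ => ?_
  rw [mul_assoc _ (T i j k)]
  congr 1
  simp only [Matrix.mul_apply, Matrix.transpose_apply, Fintype.sum_prod_type, Matrix.of_apply,
    Fin.sum_univ_three]
  ring

theorem changeFrame_swap_left {P : Matrix (Fin 3) (Fin 3) ℝ} {T : Fin 3 → Fin 3 → Fin 3 → ℝ}
    (hT : ∀ i j k, T i j k = T j i k) (i j k : Fin 3) :
    changeFrame P T i j k = changeFrame P T j i k := by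
  unfold changeFrame
  rw [Finset.sum_comm]
  refine Finset.sum_congr rfl fun b _ => Finset.sum_congr rfl fun a _ =>
    Finset.sum_congr rfl fun c _ => ?_
  rw [hT]; ring

theorem changeFrame_swap_right {P : Matrix (Fin 3) (Fin 3) ℝ} {T : Fin 3 → Fin 3 → Fin 3 → ℝ}
    (hT : ∀ i j k, T i j k = T i k j) (i j k : Fin 3) :
    changeFrame P T i j k = changeFrame P T i k j := by
  unfold changeFrame
  refine Finset.sum_congr rfl fun a _ => ?_
  rw [Finset.sum_comm]
  refine Finset.sum_congr rfl fun c _ => Finset.sum_congr rfl fun b _ => ?_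
  rw [hT]; ring

theorem changeFrame_diag (P : Matrix (Fin 3) (Fin 3) ℝ) (T : Fin 3 → Fin 3 → Fin 3 → ℝ)
    (i k : Fin 3) :
    changeFrame P T i i k = ∑ c, P c k * (Pᵀ * Matrix.of (fun a b => T b a c) * P) i i := by
  simp only [changeFrame, Matrix.mul_apply, Matrix.transpose_apply, Matrix.of_apply,
    Fin.sum_univ_three]
  ring

/-- The refined Kato inequality for a symmetric trilinear form `T` playing the role of `∇A`, in an
arbitrary frame with metric `G` and second fundamental form `h`. -/
theorem kato_arbitrary_frame {c : ℝ} (hc : 0 < c) {G h S : Matrix (Fin 3) (Fin 3) ℝ}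
    (hG : G.PosDef) (hh : h.IsHermitian) (hS : S = G⁻¹ * h)
    (T : Fin 3 → Fin 3 → Fin 3 → ℝ)
    (hT : ∀ i j k, T i j k = T j i k) (hT' : ∀ i j k, T i j k = T i k j)
    (hR : S.trace ^ 2 = (S * S).trace) (hK : c ≤ -S.det / S.trace ^ 3)
    (D : Fin 3 → ℝ) (hD : ∀ k, D k = (G⁻¹ * Matrix.of fun a b => T b a k).trace)
    (hdR : ∀ k, S.trace * D k = (S * (G⁻¹ * Matrix.of fun a b => T b a k)).trace) :
    ∑ i, ∑ j, G⁻¹ i j * D i * D j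
      ≤ 2 * (1 + 2 / c) ^ 2 * (∑ i, ∑ j, ∑ k, ∑ a, ∑ b, ∑ c,
        G⁻¹ i a * G⁻¹ j b * G⁻¹ k c * T i j k * T a b c - ∑ i, ∑ j, G⁻¹ i j * D i * D j) := by
  obtain ⟨P, d, hGP, hd⟩ := exists_simultaneous_diagonal hG hh
  have htrS : S.trace = d 0 + d 1 + d 2 := by
    rw [hS, hGP, Matrix.mul_assoc, Matrix.trace_mul_comm, hd, Matrix.trace_diagonal,
      Fin.sum_univ_three]
  have htrSS : (S * S).trace = d 0 ^ 2 + d 1 ^ 2 + d 2 ^ 2 := by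
    have : S * S = P * ((Pᵀ * h * P) * (Pᵀ * h)) := by
      rw [hS, hGP]; simp only [Matrix.mul_assoc]
    rw [this, Matrix.trace_mul_comm]
    have : (Pᵀ * h * P) * (Pᵀ * h) * P = (Pᵀ * h * P) * (Pᵀ * h * P) := by
      simp only [Matrix.mul_assoc]
    rw [this, hd, Matrix.diagonal_mul_diagonal, Matrix.trace_diagonal, Fin.sum_univ_three]
    ring
  have hdet : S.det = d 0 * d 1 * d 2 := by
    rw [hS, hGP, Matrix.mul_assoc, Matrix.det_mul_comm, hd, Matrix.det_diagonal,
      Fin.prod_univ_three]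
  have htr : ∀ k, (G⁻¹ * Matrix.of fun a b => T b a k).trace
      = ∑ i, (Pᵀ * (Matrix.of fun a b => T b a k) * P) i i := fun k => by
    rw [hGP, Matrix.mul_assoc, Matrix.trace_mul_comm]; rfl
  have htrS' : ∀ k, (S * (G⁻¹ * Matrix.of fun a b => T b a k)).trace
      = ∑ i, d i * (Pᵀ * (Matrix.of fun a b => T b a k) * P) i i := fun k => by
    have e : S * (G⁻¹ * Matrix.of fun a b => T b a k)
        = P * ((Pᵀ * h * P) * (Pᵀ * Matrix.of fun a b => T b a k)) := by
      rw [hS, hGP]; simp only [Matrix.mul_assoc]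
    rw [e, Matrix.trace_mul_comm, Matrix.mul_assoc, hd]
    simp only [Matrix.trace, Matrix.diag_apply, Matrix.diagonal_mul]
  -- The s-th frame component of dH is the trace of T in its first two slots.
  have hDs : ∀ s, ∑ k, P k s * D k = ∑ i, changeFrame P T i i s := fun s => by
    simp only [changeFrame_diag, hD, htr, Finset.mul_sum]
    exact Finset.sum_comm
  have hgrad : ∑ i, ∑ j, G⁻¹ i j * D i * D j = ∑ s, (∑ i, changeFrame P T i i s) ^ 2 := by
    simp only [hGP, mul_assoc, sum_mul_transpose_eq_sum_sq, hDs]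
  rw [hgrad, hGP, sum_contract_eq_sum_sq]
  refine kato_principal_frame hc d (changeFrame P T) (changeFrame_swap_left hT)
    (changeFrame_swap_right hT') ?_ ?_ fun s => ?_
  · rw [htrS, htrSS] at hR
    nlinarith
  · rwa [hdet, htrS] at hK
  · have h1 : ∑ k, P k s * (S.trace * D k)
        = ∑ k, P k s * (S * (G⁻¹ * Matrix.of fun a b => T b a k)).trace := by simp only [hdR]
    have h2 : ∑ k, P k s * (S.trace * D k) = S.trace * ∑ k, P k s * D k := by
      rw [Finset.mul_sum]
      exact Finset.sum_congr rfl fun k _ => by ring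
    rw [h2, hDs, htrS] at h1
    simp only [htrS', changeFrame_diag, Fin.sum_univ_three] at h1 ⊢
    linear_combination h1

end Algebra

/-! ### Partial derivatives of vector and matrix valued functions. -/

section Calculus

variable {F : Type*} [NormedAddCommGroup F] [NormedSpace ℝ F]

theorem contDiffOn_pd {U : Set E3} (hU : IsOpen U) {f : E3 → F} (hf : ContDiffOn ℝ ∞ f U)
    (i : Fin 3) : ContDiffOn ℝ ∞ (pd i f) U :=
  (hf.fderiv_of_isOpen hU (by simp)).clm_apply contDiffOn_const

theorem differentiableAt_of_contDiffOn {U : Set E3} (hU : IsOpen U) {f : E3 → F}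
    (hf : ContDiffOn ℝ ∞ f U) {u : E3} (hu : u ∈ U) : DifferentiableAt ℝ f u :=
  (hf.contDiffAt (hU.mem_nhds hu)).differentiableAt (by simp)

theorem pd_congr {f g : E3 → F} {u : E3} (h : f =ᶠ[nhds u] g) (i : Fin 3) :
    pd i f u = pd i g u := by
  simp only [pd, h.fderiv_eq]

theorem pd_const (i : Fin 3) (a : F) (u : E3) : pd i (fun _ => a) u = 0 := by
  simp [pd]

theorem pd_sum {f : Fin 3 → E3 → F} {u : E3} (hf : ∀ j, DifferentiableAt ℝ (f j) u) (i : Fin 3) :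
    pd i (fun v => ∑ j, f j v) u = ∑ j, pd i (f j) u := by
  simp [pd, fderiv_fun_sum fun j _ => hf j]

theorem pd_mul {f g : E3 → ℝ} {u : E3} (hf : DifferentiableAt ℝ f u)
    (hg : DifferentiableAt ℝ g u) (i : Fin 3) :
    pd i (fun v => f v * g v) u = pd i f u * g u + f u * pd i g u := by
  simp [pd, fderiv_fun_mul hf hg]
  ring

theorem pd_inner {f g : E3 → E4} {u : E3} (hf : DifferentiableAt ℝ f u)
    (hg : DifferentiableAt ℝ g u) (i : Fin 3) :
    pd i (fun v => (inner ℝ (f v) (g v) : ℝ)) u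
      = inner ℝ (pd i f u) (g u) + inner ℝ (f u) (pd i g u) := by
  simp only [pd, fderiv_inner_apply ℝ hf hg]
  ring

theorem pd_comm {U : Set E3} (hU : IsOpen U) {f : E3 → F} (hf : ContDiffOn ℝ ∞ f U) {u : E3}
    (hu : u ∈ U) (i j : Fin 3) : pd i (pd j f) u = pd j (pd i f) u := by
  have hfu := hf.contDiffAt (hU.mem_nhds hu)
  have hd : DifferentiableAt ℝ (fderiv ℝ f) u :=
    differentiableAt_of_contDiffOn hU (hf.fderiv_of_isOpen hU (m := ∞) (by simp)) hu
  have key : ∀ i j, pd i (pd j f) u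
      = fderiv ℝ (fderiv ℝ f) u (EuclideanSpace.single i 1) (EuclideanSpace.single j 1) := by
    intro i j
    change fderiv ℝ (fun v => fderiv ℝ f v (EuclideanSpace.single j 1)) u _ = _
    rw [fderiv_clm_apply hd (differentiableAt_const _)]
    simp
  rw [key, key]
  exact (hfu.isSymmSndFDerivAt (by simpa using ENat.LEInfty.out)) _ _

/-- The entrywise partial derivative of a matrix valued function. -/
def pdMatrix (k : Fin 3) (A : E3 → Matrix (Fin 3) (Fin 3) ℝ) (u : E3) : Matrix (Fin 3) (Fin 3) ℝ :=
  Matrix.of fun i j => pd k (fun v => A v i j) u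

/-- Entrywise differentiability of a matrix valued function. -/
def MatrixDifferentiableAt (A : E3 → Matrix (Fin 3) (Fin 3) ℝ) (u : E3) : Prop :=
  ∀ i j, DifferentiableAt ℝ (fun v => A v i j) u

theorem MatrixDifferentiableAt.mul {A B : E3 → Matrix (Fin 3) (Fin 3) ℝ} {u : E3}
    (hA : MatrixDifferentiableAt A u) (hB : MatrixDifferentiableAt B u) :
    MatrixDifferentiableAt (fun v => A v * B v) u := fun i j => by
  simp only [Matrix.mul_apply]
  exact DifferentiableAt.fun_sum fun l _ => (hA i l).mul (hB l j)

theorem MatrixDifferentiableAt.det {A : E3 → Matrix (Fin 3) (Fin 3) ℝ} {u : E3}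
    (hA : MatrixDifferentiableAt A u) : DifferentiableAt ℝ (fun v => (A v).det) u := by
  have h : ∀ i j, DifferentiableAt ℝ (fun v => A v i j) u := hA
  simp only [Matrix.det_fin_three]
  fun_prop

theorem MatrixDifferentiableAt.inv {A : E3 → Matrix (Fin 3) (Fin 3) ℝ} {u : E3}
    (hA : MatrixDifferentiableAt A u) (hu : (A u).det ≠ 0) :
    MatrixDifferentiableAt (fun v => (A v)⁻¹) u := by
  intro i j
  simp only [Matrix.inv_def, Matrix.smul_apply, smul_eq_mul, Ring.inverse_eq_inv',
    Matrix.adjugate_apply]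
  refine (hA.det.inv hu).fun_mul (MatrixDifferentiableAt.det fun k l => ?_)
  by_cases h : k = j
  · simp [Matrix.updateRow_apply, h]
  · simpa [Matrix.updateRow_apply, h] using hA _ _

theorem pdMatrix_mul {A B : E3 → Matrix (Fin 3) (Fin 3) ℝ} {u : E3}
    (hA : MatrixDifferentiableAt A u) (hB : MatrixDifferentiableAt B u) (k : Fin 3) :
    pdMatrix k (fun v => A v * B v) u = pdMatrix k A u * B u + A u * pdMatrix k B u := by
  ext i j
  simp only [pdMatrix, Matrix.add_apply, Matrix.mul_apply, Matrix.of_apply]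
  rw [pd_sum fun l => (hA i l).fun_mul (hB l j), ← Finset.sum_add_distrib]
  exact Finset.sum_congr rfl fun l _ => pd_mul (hA i l) (hB l j) k

theorem pd_trace {A : E3 → Matrix (Fin 3) (Fin 3) ℝ} {u : E3}
    (hA : MatrixDifferentiableAt A u) (k : Fin 3) :
    pd k (fun v => (A v).trace) u = (pdMatrix k A u).trace := by
  simp only [Matrix.trace, Matrix.diag_apply]
  exact pd_sum (fun l => hA l l) k

end Calculus

/-! ### Gauss, Weingarten and Codazzi equations for a parametrized hypersurface. -/

section Parametrization

/-- `X` is a smooth immersion of the open set `U` and `N` a smooth unit normal field along it. -/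
structure IsLocalHypersurface (X N : E3 → E4) (U : Set E3) : Prop where
  isOpen : IsOpen U
  contDiffOn : ContDiffOn ℝ ∞ X U
  contDiffOn_normal : ContDiffOn ℝ ∞ N U
  linearIndependent : ∀ u ∈ U, LinearIndependent ℝ fun i => pd i X u
  norm_normal : ∀ u ∈ U, ‖N u‖ = 1
  inner_normal : ∀ u ∈ U, ∀ i, (inner ℝ (pd i X u) (N u) : ℝ) = 0

/-- The connection matrix `(Γᵐₖₗ)ₘₗ` of `∇_{∂ₖ}`. -/
def connection (X : E3 → E4) (k : Fin 3) (u : E3) : Matrix (Fin 3) (Fin 3) ℝ :=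
  Matrix.of fun m l => christoffel X m k l u

/-- The matrix of the endomorphism `∇_{∂ₖ} A`. -/
def covDerivShape (X N : E3 → E4) (k : Fin 3) (u : E3) : Matrix (Fin 3) (Fin 3) ℝ :=
  pdMatrix k (shape X N) u + connection X k u * shape X N u - shape X N u * connection X k u

theorem metric_isSymm (X : E3 → E4) (u : E3) : (metric X u)ᵀ = metric X u := by
  ext i j
  exact real_inner_comm (F := E4) _ _

theorem nablaShape_eq (X N : E3 → E4) (i j k : Fin 3) (u : E3) :
    nablaShape X N i j k u = (metric X u * covDerivShape X N k u) j i := by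
  have h2 : covDeriv X k (fun v => shape X N v *ᵥ coordField i v) u
      - shape X N u *ᵥ covDeriv X k (coordField i) u = fun m => covDerivShape X N k u m i := by
    funext m
    simp only [Pi.sub_apply, covDeriv, covDerivShape, Matrix.sub_apply, Matrix.add_apply,
      Matrix.mul_apply, Matrix.mulVec, dotProduct, pdMatrix, connection, Matrix.of_apply, coordField,
      pd_const]
    simp [Pi.single_apply]
  rw [nablaShape, h2]
  simp only [coordField, dotProduct, Matrix.mul_apply]
  refine Finset.sum_congr rfl fun m _ => ?_
  rw [mul_comm, Matrix.mulVec_single_one, Matrix.col_apply, ← congrFun₂ (metric_isSymm X u) j m,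
    Matrix.transpose_apply]

/-- Expansion of the inner product of `ℝ⁴` in a frame of a hyperplane and a unit normal. -/
theorem inner_eq_tangent_add_normal {b : Fin 3 → E4} {n : E4} (hb : LinearIndependent ℝ b)
    (hn : ‖n‖ = 1) (hbn : ∀ i, (inner ℝ (b i) n : ℝ) = 0) (v w : E4) :
    (inner ℝ v w : ℝ) = ∑ l, ((Matrix.gram ℝ b)⁻¹ *ᵥ fun i => (inner ℝ v (b i) : ℝ)) l * inner ℝ (b l) w
      + inner ℝ v n * inner ℝ n w := by
  have hdet : IsUnit (Matrix.gram ℝ b).det :=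
    (Matrix.det_gram_ne_zero_iff_linearIndependent.mpr hb).isUnit
  set a := (Matrix.gram ℝ b)⁻¹ *ᵥ fun i => (inner ℝ v (b i) : ℝ) with ha
  have hga : ∀ i, ∑ l, a l * (inner ℝ (b l) (b i) : ℝ) = inner ℝ v (b i) := by
    intro i
    have : Matrix.gram ℝ b *ᵥ a = fun i => (inner ℝ v (b i) : ℝ) := by
      rw [ha, Matrix.mulVec_mulVec, Matrix.mul_nonsing_inv _ hdet, Matrix.one_mulVec]
    have := congrFun this i
    rw [← this]
    simp only [Matrix.mulVec, dotProduct, Matrix.gram_apply]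
    exact Finset.sum_congr rfl fun l _ => by rw [mul_comm, real_inner_comm]
  have hnn : (inner ℝ n n : ℝ) = 1 := by rw [real_inner_self_eq_norm_sq, hn]; norm_num
  -- The residual z is orthogonal to the bᵢ and to n, four independent vectors of ℝ⁴, hence zero.
  set z := v - (∑ l, a l • b l + (inner ℝ v n : ℝ) • n) with hz
  have hzb : ∀ i, (inner ℝ z (b i) : ℝ) = 0 := fun i => by
    rw [hz, inner_sub_left, inner_add_left, sum_inner]
    simp only [real_inner_smul_left, hga, real_inner_comm (b i) n, hbn]
    simp
  have hzn : (inner ℝ z n : ℝ) = 0 := by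
    rw [hz, inner_sub_left, inner_add_left, sum_inner]
    simp only [real_inner_smul_left, hbn, hnn]
    simp
  have hli : LinearIndependent ℝ (Fin.cons n b : Fin 4 → E4) := by
    rw [linearIndependent_finCons]
    refine ⟨hb, fun hmem => ?_⟩
    have : n ∈ (Submodule.span ℝ (Set.range b)) ⊓ (Submodule.span ℝ (Set.range b))ᗮ := by
      refine ⟨hmem, ?_⟩
      refine (Submodule.mem_orthogonal _ _).mpr ?_
      intro y hy
      induction hy using Submodule.span_induction with
      | mem x hx => obtain ⟨i, rfl⟩ := hx; exact hbn i
      | zero => simp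
      | add x y _ _ hx hy => rw [inner_add_left, hx, hy, add_zero]
      | smul r x _ hx => rw [inner_smul_left, hx, mul_zero]
    rw [Submodule.inf_orthogonal_eq_bot] at this
    rw [(Submodule.mem_bot ℝ).mp this, norm_zero] at hn
    exact zero_ne_one hn
  have hspan : Submodule.span ℝ (Set.range (Fin.cons n b : Fin 4 → E4)) = ⊤ :=
    hli.span_eq_top_of_card_eq_finrank (by simp)
  have hz0 : z = 0 := by
    have hall : ∀ y ∈ Submodule.span ℝ (Set.range (Fin.cons n b : Fin 4 → E4)),
        (inner ℝ z y : ℝ) = 0 := by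
      intro y hy
      induction hy using Submodule.span_induction with
      | mem x hx =>
        obtain ⟨i, rfl⟩ := hx
        refine Fin.cases ?_ (fun i => ?_) i
        · simpa using hzn
        · simpa using hzb i
      | zero => simp
      | add x y _ _ hx hy => rw [inner_add_right, hx, hy, add_zero]
      | smul r x _ hx => rw [inner_smul_right, hx, mul_zero]
    exact inner_self_eq_zero.mp (hall z (by rw [hspan]; trivial))
  rw [show (inner ℝ v w : ℝ) = inner ℝ (∑ l, a l • b l + (inner ℝ v n : ℝ) • n) w by
    rw [← sub_eq_zero.mp hz0], inner_add_left, sum_inner]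
  simp only [real_inner_smul_left]

namespace IsLocalHypersurface

variable {X N : E3 → E4} {U : Set E3} {u : E3}

theorem contDiffOn_pd_pd (hX : IsLocalHypersurface X N U) (i j : Fin 3) :
    ContDiffOn ℝ ∞ (pd i (pd j X)) U :=
  contDiffOn_pd hX.isOpen (contDiffOn_pd hX.isOpen hX.contDiffOn j) i

theorem differentiableAt_normal (hX : IsLocalHypersurface X N U) (hu : u ∈ U) :
    DifferentiableAt ℝ N u :=
  differentiableAt_of_contDiffOn hX.isOpen hX.contDiffOn_normal hu

theorem differentiableAt_pd (hX : IsLocalHypersurface X N U) (hu : u ∈ U) (i : Fin 3) :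
    DifferentiableAt ℝ (pd i X) u :=
  differentiableAt_of_contDiffOn hX.isOpen (contDiffOn_pd hX.isOpen hX.contDiffOn i) hu

theorem differentiableAt_pd_pd (hX : IsLocalHypersurface X N U) (hu : u ∈ U) (i j : Fin 3) :
    DifferentiableAt ℝ (pd i (pd j X)) u :=
  differentiableAt_of_contDiffOn hX.isOpen (hX.contDiffOn_pd_pd i j) hu

theorem metric_posDef (hX : IsLocalHypersurface X N U) (hu : u ∈ U) : (metric X u).PosDef :=
  Matrix.posDef_gram_of_linearIndependent (hX.linearIndependent u hu)

theorem isUnit_det_metric (hX : IsLocalHypersurface X N U) (hu : u ∈ U) :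
    IsUnit (metric X u).det :=
  (hX.metric_posDef hu).det_pos.ne'.isUnit

theorem metric_mul_shape (hX : IsLocalHypersurface X N U) (hu : u ∈ U) :
    metric X u * shape X N u = secondForm X N u :=
  Matrix.mul_nonsing_inv_cancel_left _ _ (hX.isUnit_det_metric hu)

theorem secondForm_isSymm (hX : IsLocalHypersurface X N U) (hu : u ∈ U) :
    (secondForm X N u)ᵀ = secondForm X N u := by
  ext i j
  change (inner ℝ (pd j (pd i X) u) (N u) : ℝ) = inner ℝ (pd i (pd j X) u) (N u)
  rw [pd_comm hX.isOpen hX.contDiffOn hu]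

theorem inner_normal_pd_normal (hX : IsLocalHypersurface X N U) (hu : u ∈ U) (k : Fin 3) :
    (inner ℝ (N u) (pd k N u) : ℝ) = 0 := by
  have h : (fun v => (inner ℝ (N v) (N v) : ℝ)) =ᶠ[nhds u] fun _ => 1 := by
    filter_upwards [hX.isOpen.mem_nhds hu] with v hv
    rw [real_inner_self_eq_norm_sq, hX.norm_normal v hv, one_pow]
  have h1 := pd_congr h k
  rw [pd_const, pd_inner (hX.differentiableAt_normal hu) (hX.differentiableAt_normal hu),
    real_inner_comm] at h1
  linarith

/-- The Weingarten equation. -/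
theorem secondForm_eq_neg_inner (hX : IsLocalHypersurface X N U) (hu : u ∈ U) (i j : Fin 3) :
    secondForm X N u i j = -inner ℝ (pd j X u) (pd i N u) := by
  have h : (fun v => (inner ℝ (pd j X v) (N v) : ℝ)) =ᶠ[nhds u] fun _ => 0 := by
    filter_upwards [hX.isOpen.mem_nhds hu] with v hv using hX.inner_normal v hv j
  have h1 := pd_congr h i
  rw [pd_const, pd_inner (hX.differentiableAt_pd hu j) (hX.differentiableAt_normal hu)] at h1
  change (inner ℝ (pd i (pd j X) u) (N u) : ℝ) = _
  linarith

theorem pd_metric (hX : IsLocalHypersurface X N U) (hu : u ∈ U) (i j k : Fin 3) :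
    pd k (fun v => metric X v i j) u
      = inner ℝ (pd k (pd i X) u) (pd j X u) + inner ℝ (pd i X u) (pd k (pd j X) u) :=
  pd_inner (hX.differentiableAt_pd hu i) (hX.differentiableAt_pd hu j) k

theorem christoffel_eq (hX : IsLocalHypersurface X N U) (hu : u ∈ U) (m i j : Fin 3) :
    christoffel X m i j u
      = ((metric X u)⁻¹ *ᵥ fun l => (inner ℝ (pd i (pd j X) u) (pd l X u) : ℝ)) m := by
  simp only [christoffel, Matrix.mulVec, dotProduct, hX.pd_metric hu]
  rw [Finset.mul_sum]
  refine Finset.sum_congr rfl fun l _ => ?_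
  rw [pd_comm hX.isOpen hX.contDiffOn hu j i, pd_comm hX.isOpen hX.contDiffOn hu l i,
    pd_comm hX.isOpen hX.contDiffOn hu l j, real_inner_comm (pd j X u) (pd i (pd l X) u),
    real_inner_comm (pd j (pd l X) u) (pd i X u)]
  ring

theorem christoffel_comm (hX : IsLocalHypersurface X N U) (hu : u ∈ U) (m i j : Fin 3) :
    christoffel X m i j u = christoffel X m j i u := by
  rw [hX.christoffel_eq hu, hX.christoffel_eq hu, pd_comm hX.isOpen hX.contDiffOn hu]

theorem metric_mul_connection (hX : IsLocalHypersurface X N U) (hu : u ∈ U) (j k l : Fin 3) :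
    (metric X u * connection X k u) j l = inner ℝ (pd k (pd l X) u) (pd j X u) := by
  have h : metric X u *ᵥ (fun m => christoffel X m k l u)
      = fun l' => (inner ℝ (pd k (pd l X) u) (pd l' X u) : ℝ) := by
    simp only [hX.christoffel_eq hu]
    change metric X u *ᵥ ((metric X u)⁻¹ *ᵥ _) = _
    rw [Matrix.mulVec_mulVec, Matrix.mul_nonsing_inv _ (hX.isUnit_det_metric hu),
      Matrix.one_mulVec]
  exact congrFun h j

theorem pdMatrix_metric (hX : IsLocalHypersurface X N U) (hu : u ∈ U) (k : Fin 3) :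
    pdMatrix k (metric X) u
      = metric X u * connection X k u + (metric X u * connection X k u)ᵀ := by
  ext i j
  rw [Matrix.add_apply, Matrix.transpose_apply, hX.metric_mul_connection hu,
    hX.metric_mul_connection hu, pdMatrix, Matrix.of_apply, hX.pd_metric hu,
    real_inner_comm (pd i X u), add_comm]

theorem matrixDifferentiableAt_metric (hX : IsLocalHypersurface X N U) (hu : u ∈ U) :
    MatrixDifferentiableAt (metric X) u := fun i j =>
  (hX.differentiableAt_pd hu i).inner ℝ (hX.differentiableAt_pd hu j)

theorem matrixDifferentiableAt_secondForm (hX : IsLocalHypersurface X N U) (hu : u ∈ U) :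
    MatrixDifferentiableAt (secondForm X N) u := fun i j =>
  (hX.differentiableAt_pd_pd hu i j).inner ℝ (hX.differentiableAt_normal hu)

theorem matrixDifferentiableAt_shape (hX : IsLocalHypersurface X N U) (hu : u ∈ U) :
    MatrixDifferentiableAt (shape X N) u :=
  ((hX.matrixDifferentiableAt_metric hu).inv (hX.isUnit_det_metric hu).ne_zero).mul
    (hX.matrixDifferentiableAt_secondForm hu)

/-- The derivative ∂ₖN is tangent, so only the tangential part Γᵐᵢⱼ ∂ₘX of ∂ᵢ∂ⱼX pairs with it, and
Weingarten turns ⟨∂ₘX, ∂ₖN⟩ into -hₖₘ. -/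
theorem pd_secondForm (hX : IsLocalHypersurface X N U) (hu : u ∈ U) (i j k : Fin 3) :
    pd k (fun v => secondForm X N v i j) u
      = inner ℝ (pd k (pd i (pd j X)) u) (N u)
        - ∑ m, christoffel X m i j u * secondForm X N u k m := by
  have h1 : pd k (fun v => secondForm X N v i j) u = _ :=
    pd_inner (hX.differentiableAt_pd_pd hu i j) (hX.differentiableAt_normal hu) k
  have h2 := inner_eq_tangent_add_normal (hX.linearIndependent u hu) (hX.norm_normal u hu)
    (hX.inner_normal u hu) (pd i (pd j X) u) (pd k N u)
  rw [h1, h2, hX.inner_normal_pd_normal hu, mul_zero, add_zero, sub_eq_add_neg,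
    ← Finset.sum_neg_distrib]
  congr 1
  refine Finset.sum_congr rfl fun m _ => ?_
  rw [hX.secondForm_eq_neg_inner hu, hX.christoffel_eq hu]
  simp only [mul_neg, neg_neg]
  rfl

/-- Differentiate h = G S and insert the metric compatibility `pdMatrix_metric`: lowering an index
commutes with ∇, so G ∇ₖA = ∇ₖh. -/
theorem metric_mul_covDerivShape (hX : IsLocalHypersurface X N U) (hu : u ∈ U) (k : Fin 3) :
    metric X u * covDerivShape X N k u
      = pdMatrix k (secondForm X N) u - (connection X k u)ᵀ * secondForm X N u
        - secondForm X N u * connection X k u := by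
  have h : pdMatrix k (secondForm X N) u = pdMatrix k (fun v => metric X v * shape X N v) u := by
    ext i j
    refine pd_congr ?_ k
    filter_upwards [hX.isOpen.mem_nhds hu] with v hv
    rw [hX.metric_mul_shape hv]
  rw [h, pdMatrix_mul (hX.matrixDifferentiableAt_metric hu) (hX.matrixDifferentiableAt_shape hu),
    hX.pdMatrix_metric hu, ← hX.metric_mul_shape hu, covDerivShape, Matrix.transpose_mul,
    metric_isSymm]
  noncomm_ring

/-- The Codazzi equations, in the form of an expression symmetric in all the indices. -/
theorem nablaShape_eq_symmetric (hX : IsLocalHypersurface X N U) (hu : u ∈ U) (i j k : Fin 3) :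
    nablaShape X N i j k u = inner ℝ (pd k (pd j (pd i X)) u) (N u)
      - ∑ m, (christoffel X m j i u * secondForm X N u k m
        + christoffel X m k j u * secondForm X N u i m
        + christoffel X m k i u * secondForm X N u j m) := by
  rw [nablaShape_eq, hX.metric_mul_covDerivShape hu]
  simp only [Matrix.sub_apply, Matrix.mul_apply, Matrix.transpose_apply, pdMatrix, Matrix.of_apply,
    connection]
  rw [hX.pd_secondForm hu]
  have hs : ∀ m, secondForm X N u m i = secondForm X N u i m := fun m =>
    congrFun₂ (hX.secondForm_isSymm hu) i m
  simp only [hs, Finset.sum_add_distrib, mul_comm (secondForm X N u j _)]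
  ring

theorem nablaShape_swap_left (hX : IsLocalHypersurface X N U) (hu : u ∈ U) (i j k : Fin 3) :
    nablaShape X N i j k u = nablaShape X N j i k u := by
  have h : pd k (pd j (pd i X)) u = pd k (pd i (pd j X)) u := by
    refine pd_congr ?_ k
    filter_upwards [hX.isOpen.mem_nhds hu] with v hv using pd_comm hX.isOpen hX.contDiffOn hv j i
  rw [hX.nablaShape_eq_symmetric hu, hX.nablaShape_eq_symmetric hu, h]
  congr 1
  refine Finset.sum_congr rfl fun m _ => ?_
  rw [hX.christoffel_comm hu m j i]
  ring

theorem nablaShape_swap_right (hX : IsLocalHypersurface X N U) (hu : u ∈ U) (i j k : Fin 3) :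
    nablaShape X N i j k u = nablaShape X N i k j u := by
  rw [hX.nablaShape_eq_symmetric hu, hX.nablaShape_eq_symmetric hu,
    pd_comm hX.isOpen (contDiffOn_pd hX.isOpen hX.contDiffOn i) hu k j]
  congr 1
  refine Finset.sum_congr rfl fun m _ => ?_
  rw [hX.christoffel_comm hu m k j]
  ring

theorem inv_metric_mul_nablaShape (hX : IsLocalHypersurface X N U) (hu : u ∈ U) (k : Fin 3) :
    (metric X u)⁻¹ * Matrix.of (fun a b => nablaShape X N b a k u) = covDerivShape X N k u := by
  have : Matrix.of (fun a b => nablaShape X N b a k u) = metric X u * covDerivShape X N k u := by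
    ext a b
    exact nablaShape_eq X N b a k u
  rw [this, Matrix.nonsing_inv_mul_cancel_left _ _ (hX.isUnit_det_metric hu)]

/-- The connection enters only through a commutator with the shape matrix, which has trace zero. -/
theorem pd_trace_shape (hX : IsLocalHypersurface X N U) (hu : u ∈ U) (k : Fin 3) :
    pd k (fun v => (shape X N v).trace) u = (covDerivShape X N k u).trace := by
  rw [pd_trace (hX.matrixDifferentiableAt_shape hu), covDerivShape, Matrix.trace_sub,
    Matrix.trace_add, Matrix.trace_mul_comm (connection X k u), add_sub_cancel_right]

theorem pd_trace_shape_sq (hX : IsLocalHypersurface X N U) (hu : u ∈ U) (k : Fin 3) :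
    pd k (fun v => (shape X N v * shape X N v).trace) u
      = 2 * (shape X N u * covDerivShape X N k u).trace := by
  have hS := hX.matrixDifferentiableAt_shape hu
  have h : (shape X N u * (connection X k u * shape X N u)).trace
      = (shape X N u * (shape X N u * connection X k u)).trace := by
    rw [← Matrix.mul_assoc, Matrix.trace_mul_comm]
  rw [pd_trace (hS.mul hS), pdMatrix_mul hS hS, Matrix.trace_add,
    Matrix.trace_mul_comm (pdMatrix k (shape X N) u), covDerivShape, Matrix.mul_sub,
    Matrix.mul_add, Matrix.trace_sub, Matrix.trace_add, h]
  ring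

/-- The refined Kato inequality for a parametrized hypersurface with vanishing second elementary
symmetric function of the principal curvatures. -/
theorem kato (hX : IsLocalHypersurface X N U) (hu : u ∈ U) {c : ℝ} (hc : 0 < c)
    (hR : ∀ v ∈ U, (shape X N v).trace ^ 2 = (shape X N v * shape X N v).trace)
    (hK : c ≤ -(shape X N u).det / (shape X N u).trace ^ 3) :
    ∑ i, ∑ j, (metric X u)⁻¹ i j * pd i (fun v => (shape X N v).trace) u
        * pd j (fun v => (shape X N v).trace) u
      ≤ 2 * (1 + 2 / c) ^ 2 * (∑ i, ∑ j, ∑ k, ∑ a, ∑ b, ∑ c,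
        (metric X u)⁻¹ i a * (metric X u)⁻¹ j b * (metric X u)⁻¹ k c * nablaShape X N i j k u
          * nablaShape X N a b c u
        - ∑ i, ∑ j, (metric X u)⁻¹ i j * pd i (fun v => (shape X N v).trace) u
          * pd j (fun v => (shape X N v).trace) u) := by
  have hS := hX.matrixDifferentiableAt_shape hu
  have htr : DifferentiableAt ℝ (fun v => (shape X N v).trace) u :=
    DifferentiableAt.fun_sum fun i _ => hS i i
  refine kato_arbitrary_frame (S := shape X N u) hc (hX.metric_posDef hu) (hX.secondForm_isSymm hu) rfl
    (fun i j k => nablaShape X N i j k u) (hX.nablaShape_swap_left hu)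
    (hX.nablaShape_swap_right hu) (hR u hu) hK _ (fun k => ?_) fun k => ?_
  · rw [hX.inv_metric_mul_nablaShape hu, hX.pd_trace_shape hu]
  · rw [hX.inv_metric_mul_nablaShape hu]
    -- This identity holds on a neighbourhood, so it may be differentiated: 2H ∂ₖH = 2 tr(A ∇ₖA).
    have h : (fun v => (shape X N v).trace * (shape X N v).trace)
        =ᶠ[nhds u] fun v => (shape X N v * shape X N v).trace := by
      filter_upwards [hX.isOpen.mem_nhds hu] with v hv
      rw [← sq, hR v hv]
    have h1 := pd_congr h k
    rw [hX.pd_trace_shape_sq hu, pd_mul htr htr] at h1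
    linarith

end IsLocalHypersurface

end Parametrization

/-! ### Behaviour of metric, second form and shape matrix under a change of frame. -/

section ChangeOfChart

theorem metric_change {X X' : E3 → E4} {u u' : E3} {J : Matrix (Fin 3) (Fin 3) ℝ}
    (hJ : ∀ i, pd i X' u' = ∑ a, J a i • pd a X u) : metric X' u' = Jᵀ * metric X u * J := by
  ext i j
  simp only [metric, Matrix.of_apply, hJ, Matrix.mul_apply, Matrix.transpose_apply, sum_inner,
    inner_sum, real_inner_smul_left, real_inner_smul_right, Finset.sum_mul]
  exact Finset.sum_congr rfl fun a _ => Finset.sum_congr rfl fun b _ => by ring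

namespace IsLocalHypersurface

variable {X N X' N' : E3 → E4} {U U' : Set E3} {u u' : E3} {J : Matrix (Fin 3) (Fin 3) ℝ}

/-- In Weingarten form the second fundamental form involves only first derivatives of X and N, so J
is needed at a single point and never differentiated. -/
theorem secondForm_change (hX : IsLocalHypersurface X N U) (hu : u ∈ U)
    (hX' : IsLocalHypersurface X' N' U') (hu' : u' ∈ U')
    (hJ : ∀ i, pd i X' u' = ∑ a, J a i • pd a X u)
    (hJN : ∀ i, pd i N' u' = ∑ a, J a i • pd a N u) :
    secondForm X' N' u' = Jᵀ * secondForm X N u * J := by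
  ext i j
  simp only [hX.secondForm_eq_neg_inner hu, hX'.secondForm_eq_neg_inner hu', hJ, hJN,
    Matrix.mul_apply, Matrix.transpose_apply, sum_inner, inner_sum, real_inner_smul_left,
    real_inner_smul_right, Finset.sum_mul, ← Finset.sum_neg_distrib]
  rw [Finset.sum_comm]
  exact Finset.sum_congr rfl fun a _ => Finset.sum_congr rfl fun b _ => by ring

/-- The matrices of the shape operator in two frames of the same tangent space are similar. -/
theorem shape_change (hX : IsLocalHypersurface X N U) (hu : u ∈ U)
    (hX' : IsLocalHypersurface X' N' U') (hu' : u' ∈ U')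
    (hJ : ∀ i, pd i X' u' = ∑ a, J a i • pd a X u)
    (hJN : ∀ i, pd i N' u' = ∑ a, J a i • pd a N u) :
    IsUnit J ∧ shape X' N' u' = J⁻¹ * shape X N u * J := by
  -- Nondegeneracy of the second metric Jᵀ G J forces det J ≠ 0.
  have hdet : IsUnit J.det := by
    have h := (hX'.metric_posDef hu').det_pos.ne'
    rw [metric_change hJ, Matrix.det_mul] at h
    exact (right_ne_zero_of_mul h).isUnit
  have hdetT : IsUnit Jᵀ.det := by rwa [Matrix.det_transpose]
  refine ⟨(Matrix.isUnit_iff_isUnit_det J).mpr hdet, ?_⟩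
  rw [shape, metric_change hJ, hX.secondForm_change hu hX' hu' hJ hJN, Matrix.mul_inv_rev,
    Matrix.mul_inv_rev, shape]
  simp only [Matrix.mul_assoc]
  rw [Matrix.nonsing_inv_mul_cancel_left _ _ hdetT]

end IsLocalHypersurface

end ChangeOfChart

/-! ### From charts to the manifold. -/

section Global

variable {M : Type u} [TopologicalSpace M] [ChartedSpace E3 M]

theorem scalarCurvature_eq (x η : M → E4) (p : M) :
    2 * scalarCurvature x η p = (shapeAt x η p).trace ^ 2 - (shapeAt x η p * shapeAt x η p).trace := by
  simp only [scalarCurvature, Matrix.trace_fin_three, Matrix.mul_apply, Fin.sum_univ_three]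
  ring

theorem range_modelE3 : Set.range (𝓡 3) = Set.univ := (𝓡 3).range_eq_univ

variable [IsManifold (𝓡 3) ∞ M]

theorem contDiffOn_inChart {f : M → E4} (hf : ContMDiff (𝓡 3) (𝓡 4) ∞ f) (p : M) :
    ContDiffOn ℝ ∞ (inChart f p) (extChartAt (𝓡 3) p).target :=
  (hf.comp_contMDiffOn (contMDiffOn_extChartAt_symm p)).contDiffOn

/-- The derivative of `f : M → ℝ⁴` at `q`, on the model space of the tangent space. -/
def derivAt (f : M → E4) (q : M) : E3 →L[ℝ] E4 := mfderiv (𝓡 3) (𝓡 4) f q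

/-- The derivative of the inverse of the preferred chart at `p`. -/
def chartFrame (p : M) (u : E3) : E3 →L[ℝ] E3 :=
  mfderiv (𝓡 3) (𝓡 3) (extChartAt (𝓡 3) p).symm u

theorem isInvertible_chartFrame {p : M} {u : E3} (hu : u ∈ (extChartAt (𝓡 3) p).target) :
    (chartFrame p u).IsInvertible := by
  have : IsManifold (𝓡 3) 1 M := IsManifold.of_le (n := ∞) (by simp)
  have h := isInvertible_mfderivWithin_extChartAt_symm hu
  rwa [range_modelE3, mfderivWithin_univ] at h

theorem fderiv_inChart {f : M → E4} (hf : ContMDiff (𝓡 3) (𝓡 4) ∞ f) {p : M} {u : E3}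
    (hu : u ∈ (extChartAt (𝓡 3) p).target) :
    fderiv ℝ (inChart f p) u = (derivAt f ((extChartAt (𝓡 3) p).symm u)).comp (chartFrame p u) := by
  have : IsManifold (𝓡 3) 1 M := IsManifold.of_le (n := ∞) (by simp)
  have h1 : MDifferentiableAt (𝓡 3) (𝓡 3) (extChartAt (𝓡 3) p).symm u := by
    have := mdifferentiableWithinAt_extChartAt_symm hu
    rwa [range_modelE3, mdifferentiableWithinAt_univ] at this
  have h2 : MDifferentiableAt (𝓡 3) (𝓡 4) f ((extChartAt (𝓡 3) p).symm u) :=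
    hf.mdifferentiable (by simp) _
  have h3 := mfderiv_comp u h2 h1
  rwa [mfderiv_eq_fderiv] at h3

variable {x η : M → E4}

theorem IsImmersedHypersurface.isLocalHypersurface (h : IsImmersedHypersurface x η) (p : M) :
    IsLocalHypersurface (inChart x p) (inChart η p) (extChartAt (𝓡 3) p).target where
  isOpen := isOpen_extChartAt_target p
  contDiffOn := contDiffOn_inChart h.contMDiff_immersion p
  contDiffOn_normal := contDiffOn_inChart h.contMDiff_normal p
  linearIndependent u hu := by
    have hb : LinearIndependent ℝ fun i : Fin 3 => (EuclideanSpace.single i (1 : ℝ) : E3) := by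
      have := (EuclideanSpace.basisFun (Fin 3) ℝ).toBasis.linearIndependent
      have e : ⇑(EuclideanSpace.basisFun (Fin 3) ℝ).toBasis
          = fun i : Fin 3 => (EuclideanSpace.single i (1 : ℝ) : E3) := by
        funext i
        simp
      rwa [e] at this
    have hinj : Function.Injective (fderiv ℝ (inChart x p) u) := by
      rw [fderiv_inChart h.contMDiff_immersion hu]
      exact (h.injective_mfderiv _).comp (isInvertible_chartFrame hu).injective
    exact hb.map' (fderiv ℝ (inChart x p) u).toLinearMap (LinearMap.ker_eq_bot.mpr hinj)
  norm_normal u _ := h.norm_normal _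
  inner_normal u hu i := by
    rw [pd, fderiv_inChart h.contMDiff_immersion hu, real_inner_comm]
    exact h.inner_normal _ _

/-- `shapeAt` uses a different preferred chart at each point. Similarity to the matrix in one fixed
chart lets its invariants be differentiated there. -/
theorem IsImmersedHypersurface.exists_shapeAt_eq (h : IsImmersedHypersurface x η) {p : M} {u : E3}
    (hu : u ∈ (extChartAt (𝓡 3) p).target) :
    ∃ J : Matrix (Fin 3) (Fin 3) ℝ, IsUnit J ∧
      shapeAt x η ((extChartAt (𝓡 3) p).symm u)
        = J⁻¹ * shape (inChart x p) (inChart η p) u * J := by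
  set q := (extChartAt (𝓡 3) p).symm u with hq
  have hqu : coord q ∈ (extChartAt (𝓡 3) q).target := mem_extChartAt_target q
  have hqq : (extChartAt (𝓡 3) q).symm (coord q) = q := extChartAt_to_inv q
  -- The vector w depends on the two charts only, so the same J serves both x and η.
  have key : ∀ i : Fin 3, ∃ w : E3, ∀ f : M → E4, ContMDiff (𝓡 3) (𝓡 4) ∞ f →
      pd i (inChart f q) (coord q) = ∑ a, w a • pd a (inChart f p) u := by
    intro i
    obtain ⟨w, hw⟩ :=
      (isInvertible_chartFrame hu).surjective (chartFrame q (coord q) (EuclideanSpace.single i 1))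
    refine ⟨w, fun f hf => ?_⟩
    have e : w = ∑ a, w a • (EuclideanSpace.single a (1 : ℝ) : E3) := by
      ext b
      simp [Pi.single_apply]
    have h1 : fderiv ℝ (inChart f p) u w = ∑ a, w a • pd a (inChart f p) u := by
      conv_lhs => rw [e, map_sum]
      simp only [map_smul, pd]
    rw [← h1, pd, fderiv_inChart hf hu, fderiv_inChart hf hqu, hqq, ContinuousLinearMap.comp_apply,
      ContinuousLinearMap.comp_apply, hw]
  choose w hw using key
  exact ⟨_, (h.isLocalHypersurface p).shape_change hu (h.isLocalHypersurface q) hqu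
    (J := Matrix.of fun a i => w i a) (fun i => hw i x h.contMDiff_immersion)
    (fun i => hw i η h.contMDiff_normal)⟩

theorem IsImmersedHypersurface.trace_shape_eq (h : IsImmersedHypersurface x η) {p : M} {u : E3}
    (hu : u ∈ (extChartAt (𝓡 3) p).target) :
    (shape (inChart x p) (inChart η p) u).trace
      = meanCurvature x η ((extChartAt (𝓡 3) p).symm u) := by
  obtain ⟨J, hJ, hS⟩ := h.exists_shapeAt_eq hu
  rw [meanCurvature, hS, Matrix.trace_mul_comm, ← Matrix.mul_assoc,
    Matrix.mul_nonsing_inv _ ((Matrix.isUnit_iff_isUnit_det J).mp hJ), Matrix.one_mul]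

theorem IsImmersedHypersurface.trace_shape_sq_eq (h : IsImmersedHypersurface x η)
    (hR : ∀ p, scalarCurvature x η p = 0) {p : M} {u : E3}
    (hu : u ∈ (extChartAt (𝓡 3) p).target) :
    (shape (inChart x p) (inChart η p) u).trace ^ 2
      = (shape (inChart x p) (inChart η p) u * shape (inChart x p) (inChart η p) u).trace := by
  have hq := scalarCurvature_eq x η ((extChartAt (𝓡 3) p).symm u)
  obtain ⟨J, hJ, hS⟩ := h.exists_shapeAt_eq hu
  have hJ' := Matrix.mul_nonsing_inv _ ((Matrix.isUnit_iff_isUnit_det J).mp hJ)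
  rw [hR, mul_zero, eq_comm, sub_eq_zero] at hq
  rw [h.trace_shape_eq hu]
  refine hq.trans ?_
  rw [hS]
  set S := shape (inChart x p) (inChart η p) u
  calc (J⁻¹ * S * J * (J⁻¹ * S * J)).trace = (J⁻¹ * (S * (J * J⁻¹) * S * J)).trace := by
        simp only [Matrix.mul_assoc]
    _ = _ := by
        rw [hJ', Matrix.mul_one, Matrix.trace_mul_comm, Matrix.mul_assoc, hJ', Matrix.mul_one]

end Global

end Hypersurface
end

theorem mainTheorem6 (c : ℝ) (hc : 0 < c) :
    ∃ c₀ : ℝ, 0 < c₀ ∧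
      ∀ (M : Type u) [TopologicalSpace M] [ChartedSpace Hypersurface.E3 M]
        [IsManifold (𝓡 3) ∞ M] (x η : M → Hypersurface.E4),
        Hypersurface.IsImmersedHypersurface x η →
        (∀ p, Hypersurface.scalarCurvature x η p = 0) →
        (∀ p, -Hypersurface.gaussKronecker x η p / Hypersurface.meanCurvature x η p ^ 3 ≥ c) →
        ∀ p, Hypersurface.normSqNablaShape x η p
              - Hypersurface.normSqGrad x (Hypersurface.meanCurvature x η) p
            ≥ 2 / (1 + 2 * c₀ ^ 2)
              * Hypersurface.normSqGrad x (Hypersurface.meanCurvature x η) p := by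
  -- With t = (1 + 2/c)² and D = |∇A|² - |∇H|², the bound |∇H|² ≤ 2tD yields 2|∇H|² ≤ 4tD ≤ (1 +
  -- 8t)D, and 8t = 2c₀².
  refine ⟨2 * (1 + 2 / c), by positivity, fun M _ _ _ x η h hR hK p => ?_⟩
  have hpU := mem_extChartAt_target (I := 𝓡 3) p
  have kato := (h.isLocalHypersurface p).kato hpU hc (fun v hv => h.trace_shape_sq_eq hR hv) (hK p)
  have hpd : ∀ i, Hypersurface.pd i (fun v => (Hypersurface.shape (Hypersurface.inChart x p)
        (Hypersurface.inChart η p) v).trace) (extChartAt (𝓡 3) p p)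
      = Hypersurface.pd i (Hypersurface.inChart (Hypersurface.meanCurvature x η) p)
        (Hypersurface.coord p) := fun i => by
    refine Hypersurface.pd_congr ?_ i
    filter_upwards [(isOpen_extChartAt_target p).mem_nhds hpU] with v hv
    exact h.trace_shape_eq hv
  simp only [hpd] at kato
  change Hypersurface.normSqGrad x (Hypersurface.meanCurvature x η) p
    ≤ 2 * (1 + 2 / c) ^ 2 * (Hypersurface.normSqNablaShape x η p
      - Hypersurface.normSqGrad x (Hypersurface.meanCurvature x η) p) at kato
  set A := Hypersurface.normSqGrad x (Hypersurface.meanCurvature x η) p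
  set D := Hypersurface.normSqNablaShape x η p - A
  have ht : 0 < (1 + 2 / c) ^ 2 := by positivity
  -- Nonnegativity of |∇H|², from positivity of the inverse metric, gives D ≥ 0 through the Kato
  -- bound.
  have hA : 0 ≤ A := by
    have hinv := ((h.isLocalHypersurface p).metric_posDef hpU).inv.posSemidef
    have h0 := hinv.dotProduct_mulVec_nonneg fun i =>
      Hypersurface.pd i (Hypersurface.inChart (Hypersurface.meanCurvature x η) p)
        (Hypersurface.coord p)
    refine h0.trans_eq ?_
    simp only [A, Hypersurface.normSqGrad, dotProduct, Matrix.mulVec, Finset.mul_sum]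
    exact Finset.sum_congr rfl fun i _ => Finset.sum_congr rfl fun j _ => by
      simp only [Pi.star_apply, star_trivial]
      rw [← mul_assoc, mul_comm (Hypersurface.pd i _ _)]
      rfl
  rw [ge_iff_le, div_mul_eq_mul_div, div_le_iff₀ (by positivity)]
  nlinarith
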